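/- Let $d\ge 0$ and $m\ge 1$ be integers and let $\Delta$ be a simplicial polytopal fan in $\mathbb{R}^d$, that is, $\Delta$ is the normal fan $\mathcal{N}(P_0)$ of a non-empty polytope $P_0\subset\mathbb{R}^d$ and every cone in $\Delta$ is generated by linearly independent vectors. Here the normal fan $\mathcal{N}(P)$ of a polytope $P$ is the collection of the normal cones $N_F(P)=\{\mathbf{x} : \max_{\mathbf{y}\in P}\langle \mathbf{x},\mathbf{y}\rangle=\langle \mathbf{x},\mathbf{p}\rangle \text{ for all } \mathbf{p}\in F\}$ over all non-empty faces $F$ of $P$. Let $h_P(\mathbf{u})=\max_{\mathbf{x}\in P}\langle \mathbf{x},\mathbf{u}\rangle$ be the support function of $P$, and let $\mathcal{P}(\Delta)$ be the set of all non-empty polytopes whose normal fan is a coarsening of $\Delta$, i.e. each of whose normal cones is a union of cones in $\Delta$. For $U=(\mathbf{u}^{(1)},\ldots,\mathbf{u}^{(m)})^{\mathsf T}\in\mathbb{R}^{m\times d}$ and $\mathbf{y}\in\mathbb{R}^m$ let $$\hat P^\Delta(U,\mathbf{y})=\operatorname*{argmin}_{P\in\mathcal{P}(\Delta)}\frac1m\sum_{i=1}^m\bigl(h_P(\mathbf{u}^{(i)})-y^{(i)}\bigr)^2$$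 be the set of all least-squares estimates, and let $\mathcal{U}=\{U\in\mathbb{R}^{m\times d} : |\hat P^\Delta(U,\mathbf{y})|=1\text{ for all }\mathbf{y}\in\mathbb{R}^m\}$. Then, for all $U\in\mathbb{R}^{m\times d}$ outside a set of Lebesgue measure zero, the following holds: if for every inclusion-maximal cone $\sigma\in\Delta$ there is an $i\in\{1,\ldots,m\}$ such that $\mathbf{u}^{(i)}$ lies in the relative interior of $\sigma$, then $U\in\mathcal{U}$. That is, the least-squares estimate exists and is unique for every $\mathbf{y}\in\mathbb{R}^m$. -/

import Mathlib

open MeasureTheory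
open scoped RealInnerProductSpace

noncomputable section

namespace SupportRecon

/-- A polyhedron: an intersection of finitely many closed halfspaces. -/
def IsPolyhedron {d : ℕ} (P : Set (EuclideanSpace ℝ (Fin d))) : Prop :=
  ∃ (k : ℕ) (a : Fin k → EuclideanSpace ℝ (Fin d)) (b : Fin k → ℝ),
    P = {x | ∀ j, ⟪x, a j⟫ ≤ b j}

/-- A (non-empty) polytope: a non-empty bounded polyhedron. -/
structure IsPolytope {d : ℕ} (P : Set (EuclideanSpace ℝ (Fin d))) : Prop where
  polyhedron : IsPolyhedron P
  nonempty : P.Nonempty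
  bounded : Bornology.IsBounded P

/-- The support function `h_P(u) = max_{x ∈ P} ⟨x, u⟩`; for a non-empty polytope (which is compact)
the supremum is attained. -/
def supportFn {d : ℕ} (P : Set (EuclideanSpace ℝ (Fin d))) (u : EuclideanSpace ℝ (Fin d)) : ℝ :=
  sSup ((fun x => ⟪x, u⟫) '' P)

/-- `F` is a non-empty face of `P`: the non-empty set of maximizers over `P` of some linear
functional (the functional `0` gives `F = P`). -/
def IsFace {d : ℕ} (F P : Set (EuclideanSpace ℝ (Fin d))) : Prop :=
  F.Nonempty ∧ IsExposed ℝ P F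

/-- The normal cone `N_F(P)` at a face `F ⊆ P`: the directions whose maximum over `P`
is attained at every point of `F`. -/
def normalCone {d : ℕ} (F P : Set (EuclideanSpace ℝ (Fin d))) : Set (EuclideanSpace ℝ (Fin d)) :=
  {x | ∀ p ∈ F, ∀ y ∈ P, ⟪x, y⟫ ≤ ⟪x, p⟫}

/-- The normal fan of `P`: the collection of the normal cones of `P` at its non-empty faces. -/
def normalFan {d : ℕ} (P : Set (EuclideanSpace ℝ (Fin d))) :
    Set (Set (EuclideanSpace ℝ (Fin d))) :=
  {σ | ∃ F, IsFace F P ∧ σ = normalCone F P}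

/-- A simplicial polytopal fan: the normal fan of a polytope, all of whose cones are
generated by linearly independent vectors. -/
structure IsSimplicialPolytopalFan {d : ℕ} (Δ : Set (Set (EuclideanSpace ℝ (Fin d)))) : Prop where
  polytopal : ∃ P, IsPolytope P ∧ Δ = normalFan P
  simplicial : ∀ σ ∈ Δ, ∃ C : PointedCone ℝ (EuclideanSpace ℝ (Fin d)),
    C.IsSimplicial ∧ (C : Set (EuclideanSpace ℝ (Fin d))) = σ

/-- `Δ'` coarsens `Δ`: every cone in `Δ'` is a union of cones in `Δ`. -/
def Coarsens {d : ℕ} (Δ' Δ : Set (Set (EuclideanSpace ℝ (Fin d)))) : Prop :=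
  ∀ σ ∈ Δ', ∃ S ⊆ Δ, σ = ⋃₀ S

/-- The deformation cone of `Δ`: all polytopes whose normal fan is a coarsening of `Δ`. -/
def deformationCone {d : ℕ} (Δ : Set (Set (EuclideanSpace ℝ (Fin d)))) :
    Set (Set (EuclideanSpace ℝ (Fin d))) :=
  {P | IsPolytope P ∧ Coarsens (normalFan P) Δ}

/-- The mean squared error of `P` for the directions `U i` and the data `y i`. -/
def loss {d m : ℕ} (U : Fin m → EuclideanSpace ℝ (Fin d)) (y : Fin m → ℝ)
    (P : Set (EuclideanSpace ℝ (Fin d))) : ℝ :=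
  (1 / (m : ℝ)) * ∑ i, (supportFn P (U i) - y i) ^ 2

/-- The least-squares estimator: the set of all minimizers of the mean squared error over the
deformation cone of `Δ`. -/
def estimator {d m : ℕ} (Δ : Set (Set (EuclideanSpace ℝ (Fin d))))
    (U : Fin m → EuclideanSpace ℝ (Fin d)) (y : Fin m → ℝ) :
    Set (Set (EuclideanSpace ℝ (Fin d))) :=
  {P | P ∈ deformationCone Δ ∧ ∀ Q ∈ deformationCone Δ, loss U y P ≤ loss U y Q}

/-- The set of all direction matrices (given by their `m` rows) for which the estimator consists
of exactly one polytope, whatever the data `y`. -/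
def uniqueDirections {d : ℕ} (Δ : Set (Set (EuclideanSpace ℝ (Fin d)))) (m : ℕ) :
    Set (Fin m → EuclideanSpace ℝ (Fin d)) :=
  {U | ∀ y : Fin m → ℝ, (estimator Δ U y).encard = 1}

end SupportRecon

end

noncomputable section

namespace SupportRecon

section

variable {d : ℕ}

theorem IsPolyhedron.isClosed {P : Set (EuclideanSpace ℝ (Fin d))} (hP : IsPolyhedron P) :
    IsClosed P := by
  obtain ⟨k, a, b, rfl⟩ := hP
  have : {x | ∀ j, ⟪x, a j⟫ ≤ b j} = ⋂ j, {x | ⟪x, a j⟫ ≤ b j} := by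
    ext x; simp
  rw [this]
  exact isClosed_iInter fun j => isClosed_le (by fun_prop) continuous_const

theorem IsPolytope.isCompact {P : Set (EuclideanSpace ℝ (Fin d))} (hP : IsPolytope P) :
    IsCompact P :=
  Metric.isCompact_of_isClosed_isBounded hP.polyhedron.isClosed hP.bounded

theorem inner_le_supportFn {P : Set (EuclideanSpace ℝ (Fin d))} (hP : IsCompact P)
    {x : EuclideanSpace ℝ (Fin d)} (hx : x ∈ P) (u : EuclideanSpace ℝ (Fin d)) :
    ⟪x, u⟫ ≤ supportFn P u :=
  le_csSup (hP.image (f := fun x => ⟪x, u⟫) (by fun_prop)).bddAbove ⟨x, hx, rfl⟩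

theorem supportFn_eq_of_isMax {P : Set (EuclideanSpace ℝ (Fin d))}
    {x u : EuclideanSpace ℝ (Fin d)} (hx : x ∈ P) (h : ∀ y ∈ P, ⟪y, u⟫ ≤ ⟪x, u⟫) :
    supportFn P u = ⟪x, u⟫ := by
  refine IsGreatest.csSup_eq ⟨⟨x, hx, rfl⟩, ?_⟩
  rintro _ ⟨y, hy, rfl⟩
  exact h y hy

theorem isFace_argmax {P : Set (EuclideanSpace ℝ (Fin d))} (hc : IsCompact P) (hn : P.Nonempty)
    (u : EuclideanSpace ℝ (Fin d)) : IsFace {x ∈ P | ∀ y ∈ P, ⟪u, y⟫ ≤ ⟪u, x⟫} P := by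
  constructor
  · obtain ⟨x, hx, hm⟩ := hc.exists_isMaxOn hn (f := fun x => ⟪u, x⟫) (by fun_prop)
    exact ⟨x, hx, fun y hy => hm hy⟩
  · exact fun _ => ⟨innerSL ℝ u, rfl⟩

theorem mem_normalCone_argmax {P : Set (EuclideanSpace ℝ (Fin d))}
    (u : EuclideanSpace ℝ (Fin d)) : u ∈ normalCone {x ∈ P | ∀ y ∈ P, ⟪u, y⟫ ≤ ⟪u, x⟫} P :=
  fun _ hp y hy => hp.2 y hy

/-- A point of a polyhedron all of whose active constraints are active at an extreme point
is that extreme point. -/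
theorem eq_of_active_of_extreme {k : ℕ} {a : Fin k → EuclideanSpace ℝ (Fin d)} {b : Fin k → ℝ}
    {v x : EuclideanSpace ℝ (Fin d)}
    (hv : v ∈ Set.extremePoints ℝ {x : EuclideanSpace ℝ (Fin d) | ∀ j, ⟪x, a j⟫ ≤ b j})
    (hx : ∀ j, ⟪v, a j⟫ = b j → ⟪x, a j⟫ = b j) : x = v := by
  obtain ⟨hvP, hext⟩ := mem_extremePoints.1 hv
  have key : ∀ j, ∃ δ > 0, ∀ t : ℝ, |t| ≤ δ → ⟪v + t • (x - v), a j⟫ ≤ b j := by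
    intro j
    by_cases hj : ⟪v, a j⟫ = b j
    · refine ⟨1, one_pos, fun t _ => ?_⟩
      rw [inner_add_left, real_inner_smul_left, inner_sub_left, hx j hj, hj]
      simp
    · have hlt : ⟪v, a j⟫ < b j := lt_of_le_of_ne (hvP j) hj
      set c := ⟪x - v, a j⟫ with hc
      refine ⟨(b j - ⟪v, a j⟫) / (|c| + 1), div_pos (by linarith) (by positivity), fun t ht => ?_⟩
      rw [inner_add_left, real_inner_smul_left, ← hc]
      have h1 : t * c ≤ |t| * |c| := by rw [← abs_mul]; exact le_abs_self _
      have h2 : |t| * (|c| + 1) ≤ b j - ⟪v, a j⟫ := (le_div_iff₀ (by positivity)).1 ht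
      nlinarith [abs_nonneg t]
  choose δ hδ hδ' using key
  obtain ⟨ε, hε, hε'⟩ : ∃ ε > 0, ∀ j, ε ≤ δ j := by
    rcases isEmpty_or_nonempty (Fin k) with h | h
    · exact ⟨1, one_pos, fun j => h.elim j⟩
    · obtain ⟨j, hj⟩ := Finite.exists_min δ
      exact ⟨δ j, hδ j, hj⟩
  have h1 : v + ε • (x - v) ∈ {x | ∀ j, ⟪x, a j⟫ ≤ b j} := fun j =>
    hδ' j ε (by rw [abs_of_pos hε]; exact hε' j)
  have h2 : v + (-ε) • (x - v) ∈ {x | ∀ j, ⟪x, a j⟫ ≤ b j} := fun j =>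
    hδ' j (-ε) (by rw [abs_neg, abs_of_pos hε]; exact hε' j)
  have h3 := (hext _ h1 _ h2 ⟨1/2, 1/2, by norm_num, by norm_num, by norm_num, by module⟩).1
  have h4 : ε • (x - v) = 0 := by simpa using h3
  rcases smul_eq_zero.1 h4 with h | h
  · exact absurd h hε.ne'
  · exact sub_eq_zero.1 h

/-- A polytope has finitely many vertices: every linear functional attains its maximum at one of
them, and each of them is strictly exposed. -/
theorem IsPolytope.exists_vertices {P : Set (EuclideanSpace ℝ (Fin d))} (hP : IsPolytope P) :
    ∃ V : Finset (EuclideanSpace ℝ (Fin d)), (∀ v ∈ V, v ∈ P) ∧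
      (∀ u, ∃ v ∈ V, ∀ y ∈ P, ⟪u, y⟫ ≤ ⟪u, v⟫) ∧
      (∀ v ∈ V, ∃ u, ∀ y ∈ P, y ≠ v → ⟪u, y⟫ < ⟪u, v⟫) := by
  classical
  have hcomp := hP.isCompact
  have hne := hP.nonempty
  obtain ⟨k, a, b, hPeq⟩ := hP.polyhedron
  have hfin : (P.extremePoints ℝ).Finite := by
    refine Set.Finite.of_finite_image (f := fun v => {j : Fin k | ⟪v, a j⟫ = b j})
      (Set.toFinite _) ?_
    intro v hv w hw hvw
    subst hPeq
    refine eq_of_active_of_extreme hw fun j hj => ?_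
    have : j ∈ {j : Fin k | ⟪v, a j⟫ = b j} := by
      simp only at hvw
      rw [hvw]; exact hj
    exact this
  refine ⟨hfin.toFinset, fun v hv => extremePoints_subset (hfin.mem_toFinset.1 hv), fun u => ?_,
    fun v hv => ?_⟩
  · have hf := isFace_argmax hcomp hne u
    obtain ⟨v, hv⟩ := (hf.2.isCompact hcomp).extremePoints_nonempty hf.1
    exact ⟨v, hfin.mem_toFinset.2 (hf.2.isExtreme.extremePoints_subset_extremePoints hv), hv.1.2⟩
  · have hv' := hfin.mem_toFinset.1 hv
    refine ⟨∑ j with ⟪v, a j⟫ = b j, a j, fun y hy hyv => ?_⟩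
    rw [sum_inner, sum_inner]
    subst hPeq
    have hle : ∀ j ∈ Finset.univ.filter (fun j => ⟪v, a j⟫ = b j), ⟪a j, y⟫ ≤ ⟪a j, v⟫ := by
      intro j hj
      rw [real_inner_comm, real_inner_comm v, (Finset.mem_filter.1 hj).2]
      exact hy j
    refine Finset.sum_lt_sum hle ?_
    by_contra! hcon
    refine hyv (eq_of_active_of_extreme hv' fun j hj => le_antisymm (hy j) ?_)
    have := hcon j (by simpa using hj)
    rw [real_inner_comm, real_inner_comm y, hj] at this
    exact this

end

section

variable {d : ℕ}

/-- The cone of directions whose maximum over the finite set `V` is attained at `v`. -/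
def vertexCone (V : Finset (EuclideanSpace ℝ (Fin d))) (v : EuclideanSpace ℝ (Fin d)) :
    Set (EuclideanSpace ℝ (Fin d)) :=
  {u | ∀ w ∈ V, ⟪u, w⟫ ≤ ⟪u, v⟫}

theorem exists_mem_vertexCone {V : Finset (EuclideanSpace ℝ (Fin d))} (hV : V.Nonempty)
    (u : EuclideanSpace ℝ (Fin d)) : ∃ v ∈ V, u ∈ vertexCone V v :=
  V.exists_max_image (fun w => ⟪u, w⟫) hV

theorem mem_vertexCone_of_inner_eq {V : Finset (EuclideanSpace ℝ (Fin d))}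
    {u v w : EuclideanSpace ℝ (Fin d)} (hu : u ∈ vertexCone V v) (h : ⟪u, w⟫ = ⟪u, v⟫) :
    u ∈ vertexCone V w :=
  fun x hx => h ▸ hu x hx

theorem inner_eq_of_mem_vertexCone {V : Finset (EuclideanSpace ℝ (Fin d))}
    {u v w : EuclideanSpace ℝ (Fin d)} (hv : v ∈ V) (hw : w ∈ V) (hu : u ∈ vertexCone V v)
    (hu' : u ∈ vertexCone V w) : ⟪u, w⟫ = ⟪u, v⟫ :=
  le_antisymm (hu w hw) (hu' v hv)

/-- Moving from a point of a vertex cone in a direction that is compatible with all tight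
inequalities stays in the cone for a short time. -/
theorem exists_pos_add_smul_mem_vertexCone {V : Finset (EuclideanSpace ℝ (Fin d))}
    {u v x : EuclideanSpace ℝ (Fin d)} (hu : u ∈ vertexCone V v)
    (hx : ∀ w ∈ V, ⟪u, w⟫ = ⟪u, v⟫ → ⟪x, w⟫ ≤ ⟪x, v⟫) :
    ∃ ε : ℝ, 0 < ε ∧ u + ε • x ∈ vertexCone V v := by
  have key : ∀ w : V, ∃ δ : ℝ, 0 < δ ∧ ∀ t : ℝ, 0 ≤ t → t ≤ δ →
      ⟪u + t • x, (w : EuclideanSpace ℝ (Fin d))⟫ ≤ ⟪u + t • x, v⟫ := by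
    rintro ⟨w, hw⟩
    simp only [inner_add_left, real_inner_smul_left]
    by_cases h : ⟪u, w⟫ = ⟪u, v⟫
    · exact ⟨1, one_pos, fun t ht _ => by
        have := mul_le_mul_of_nonneg_left (hx w hw h) ht
        linarith⟩
    · have hlt : ⟪u, w⟫ < ⟪u, v⟫ := lt_of_le_of_ne (hu w hw) h
      set c := ⟪x, w⟫ - ⟪x, v⟫ with hc
      refine ⟨(⟪u, v⟫ - ⟪u, w⟫) / (|c| + 1), div_pos (by linarith) (by positivity),
        fun t ht ht' => ?_⟩
      have h1 : t * c ≤ t * |c| := mul_le_mul_of_nonneg_left (le_abs_self _) ht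
      have h2 : t * (|c| + 1) ≤ ⟪u, v⟫ - ⟪u, w⟫ := (le_div_iff₀ (by positivity)).1 ht'
      have h3 : t * c = t * ⟪x, w⟫ - t * ⟪x, v⟫ := by rw [hc]; ring
      nlinarith
  choose δ hδ hδ' using key
  rcases isEmpty_or_nonempty V with h | h
  · exact ⟨1, one_pos, fun w hw => h.elim ⟨w, hw⟩⟩
  · obtain ⟨w₀, hw₀⟩ := Finite.exists_min δ
    exact ⟨δ w₀, hδ w₀, fun w hw => hδ' ⟨w, hw⟩ _ (hδ w₀).le (hw₀ ⟨w, hw⟩)⟩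

/-- `V` is a finite set of points of `P` among which every linear functional attains its maximum
over `P`, all of them strictly exposed: the vertex set of `P`. -/
structure IsVertexSet (P : Set (EuclideanSpace ℝ (Fin d)))
    (V : Finset (EuclideanSpace ℝ (Fin d))) : Prop where
  subset : ∀ v ∈ V, v ∈ P
  exists_max : ∀ u, ∃ v ∈ V, ∀ y ∈ P, ⟪u, y⟫ ≤ ⟪u, v⟫
  exposed : ∀ v ∈ V, ∃ u, ∀ y ∈ P, y ≠ v → ⟪u, y⟫ < ⟪u, v⟫

namespace IsVertexSet

variable {P : Set (EuclideanSpace ℝ (Fin d))} {V : Finset (EuclideanSpace ℝ (Fin d))}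
  {v : EuclideanSpace ℝ (Fin d)}

theorem nonempty (h : IsVertexSet P V) : V.Nonempty :=
  let ⟨v, hv, _⟩ := h.exists_max 0
  ⟨v, hv⟩

theorem le_of_mem_vertexCone (h : IsVertexSet P V) {u : EuclideanSpace ℝ (Fin d)}
    (hu : u ∈ vertexCone V v) {y : EuclideanSpace ℝ (Fin d)} (hy : y ∈ P) : ⟪u, y⟫ ≤ ⟪u, v⟫ := by
  obtain ⟨w, hw, hmax⟩ := h.exists_max u
  exact (hmax y hy).trans (hu w hw)

theorem normalCone_singleton (h : IsVertexSet P V) : normalCone {v} P = vertexCone V v := by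
  ext u
  constructor
  · exact fun hu w hw => hu v rfl w (h.subset w hw)
  · rintro hu p rfl y hy
    exact h.le_of_mem_vertexCone hu hy

theorem isFace_singleton (h : IsVertexSet P V) (hv : v ∈ V) : IsFace {v} P := by
  refine ⟨Set.singleton_nonempty v, fun _ => ?_⟩
  obtain ⟨u, hu⟩ := h.exposed v hv
  refine ⟨innerSL ℝ u, Set.ext fun x => ⟨?_, ?_⟩⟩
  · rintro rfl
    refine ⟨h.subset x hv, fun y hy => ?_⟩
    rcases eq_or_ne y x with rfl | hne
    · exact le_rfl
    · exact (hu y hy hne).le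
  · rintro ⟨hx, hmax⟩
    by_contra hne
    exact absurd (hmax v (h.subset v hv)) (not_le.2 (hu x hx hne))

theorem vertexCone_mem_normalFan (h : IsVertexSet P V) (hv : v ∈ V) :
    vertexCone V v ∈ normalFan P :=
  ⟨{v}, h.isFace_singleton hv, h.normalCone_singleton.symm⟩

/-- The only cone of the normal fan that contains a direction strictly exposing the vertex `v`
is the cone of `v`. -/
theorem eq_vertexCone_of_mem (h : IsVertexSet P V) (hv : v ∈ V) {u : EuclideanSpace ℝ (Fin d)}
    (hu : ∀ y ∈ P, y ≠ v → ⟪u, y⟫ < ⟪u, v⟫) {τ : Set (EuclideanSpace ℝ (Fin d))}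
    (hτ : τ ∈ normalFan P) (huτ : u ∈ τ) : τ = vertexCone V v := by
  obtain ⟨F, hF, rfl⟩ := hτ
  have hsub : ∀ p ∈ F, p = v := by
    intro p hp
    by_contra hne
    exact absurd (huτ p hp v (h.subset v hv)) (not_le.2 (hu p (hF.2.subset hp) hne))
  have : F = {v} := Set.eq_singleton_iff_nonempty_unique_mem.2 ⟨hF.1, hsub⟩
  rw [this, h.normalCone_singleton]

theorem exposing_mem_vertexCone (h : IsVertexSet P V) {u : EuclideanSpace ℝ (Fin d)}
    (hu : ∀ y ∈ P, y ≠ v → ⟪u, y⟫ < ⟪u, v⟫) : u ∈ vertexCone V v := by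
  intro w hw
  rcases eq_or_ne w v with rfl | hne
  · exact le_rfl
  · exact (hu w (h.subset w hw) hne).le

theorem maximal_vertexCone (h : IsVertexSet P V) (hv : v ∈ V) :
    Maximal (fun τ => τ ∈ normalFan P) (vertexCone V v) := by
  refine ⟨h.vertexCone_mem_normalFan hv, fun τ hτ hle => ?_⟩
  obtain ⟨u, hu⟩ := h.exposed v hv
  exact (h.eq_vertexCone_of_mem hv hu hτ (hle (h.exposing_mem_vertexCone hu))).le

/-- Every direction `u` lies in a cone of the normal fan in whose relative interior it lies. -/
theorem exists_normalFan_mem (h : IsVertexSet P V) (hc : IsCompact P)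
    (u : EuclideanSpace ℝ (Fin d)) : ∃ τ ∈ normalFan P, u ∈ τ ∧ ∀ w ∈ τ, ∃ v ∈ V, ∃ ε : ℝ, 0 < ε ∧
      u ∈ vertexCone V v ∧ w ∈ vertexCone V v ∧ u + ε • (-w) ∈ vertexCone V v := by
  obtain ⟨v₀, hv₀⟩ := h.nonempty
  refine ⟨_, ⟨_, isFace_argmax hc ⟨v₀, h.subset v₀ hv₀⟩ u, rfl⟩, mem_normalCone_argmax u,
    fun w hw => ?_⟩
  obtain ⟨v, hv, hmax⟩ := h.exists_max u
  have huv : u ∈ vertexCone V v := fun x hx => hmax x (h.subset x hx)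
  have hwmem : ∀ x ∈ V, ⟪u, x⟫ = ⟪u, v⟫ → ∀ y ∈ P, ⟪w, y⟫ ≤ ⟪w, x⟫ := fun x hx hxe =>
    hw x ⟨h.subset x hx, fun y hy => hxe ▸ hmax y hy⟩
  obtain ⟨ε, hε, hmem⟩ := exists_pos_add_smul_mem_vertexCone (x := -w) huv (by
    intro x hx hxe
    rw [inner_neg_left, inner_neg_left]
    exact neg_le_neg (hwmem x hx hxe v (h.subset v hv)))
  exact ⟨v, hv, ε, hε, huv, fun x hx => hwmem v hv rfl x (h.subset x hx), hmem⟩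

end IsVertexSet

theorem exists_pos_add_smul_sub_mem_of_mem_intrinsicInterior {s : Set (EuclideanSpace ℝ (Fin d))}
    {x y : EuclideanSpace ℝ (Fin d)} (hx : x ∈ intrinsicInterior ℝ s) (hy : y ∈ s) :
    ∃ ε : ℝ, 0 < ε ∧ x + ε • (x - y) ∈ s := by
  obtain ⟨z, hz, rfl⟩ := mem_intrinsicInterior.1 hx
  have hmem : ∀ t : ℝ, (z : EuclideanSpace ℝ (Fin d)) + t • (z - y) ∈ affineSpan ℝ s := by
    intro t
    have := AffineMap.lineMap_mem (-t) z.2 (subset_affineSpan ℝ s hy)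
    rw [AffineMap.lineMap_apply_module'] at this
    convert this using 1
    module
  let g : ℝ → affineSpan ℝ s := fun t => ⟨(z : EuclideanSpace ℝ (Fin d)) + t • (z - y), hmem t⟩
  have hg : Continuous g := by
    apply Continuous.subtype_mk
    fun_prop
  have hg0 : g 0 = z := Subtype.ext (by simp [g])
  have hnhds : g ⁻¹' (interior ((↑) ⁻¹' s)) ∈ nhds (0 : ℝ) :=
    hg.continuousAt.preimage_mem_nhds (by rw [hg0]; exact isOpen_interior.mem_nhds hz)
  obtain ⟨ε, hε, hball⟩ := Metric.mem_nhds_iff.1 hnhds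
  refine ⟨ε / 2, by positivity, ?_⟩
  have : ε / 2 ∈ Metric.ball (0 : ℝ) ε := by
    rw [Metric.mem_ball, dist_zero_right, Real.norm_eq_abs, abs_of_pos (by positivity)]
    linarith
  have hmem' : g (ε / 2) ∈ ((↑) ⁻¹' s : Set (affineSpan ℝ s)) := interior_subset (hball this)
  exact hmem'

namespace IsVertexSet

variable {P : Set (EuclideanSpace ℝ (Fin d))} {V : Finset (EuclideanSpace ℝ (Fin d))}
  {v w : EuclideanSpace ℝ (Fin d)}

theorem eq_of_mem_intrinsicInterior (h : IsVertexSet P V) (hv : v ∈ V) (hw : w ∈ V)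
    {u : EuclideanSpace ℝ (Fin d)} (hu : u ∈ intrinsicInterior ℝ (vertexCone V v))
    (hu' : u ∈ vertexCone V w) : v = w := by
  by_contra hne
  obtain ⟨y, hy⟩ := h.exposed v hv
  obtain ⟨ε, hε, hmem⟩ := exists_pos_add_smul_sub_mem_of_mem_intrinsicInterior hu
    (h.exposing_mem_vertexCone hy)
  have h1 := inner_eq_of_mem_vertexCone hv hw (intrinsicInterior_subset hu) hu'
  have h2 := hy w (h.subset w hw) (Ne.symm hne)
  have h3 := hmem w hw
  simp only [inner_add_left, real_inner_smul_left, inner_sub_left, h1] at h3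
  nlinarith

theorem span_vertexCone (h : IsVertexSet P V) (hv : v ∈ V) :
    Submodule.span ℝ (vertexCone V v) = ⊤ := by
  obtain ⟨u, hu⟩ := h.exposed v hv
  have hum := h.exposing_mem_vertexCone hu
  refine eq_top_iff.2 fun x _ => ?_
  obtain ⟨ε, hε, hmem⟩ := exists_pos_add_smul_mem_vertexCone (x := x) hum (by
    intro w hw hwe
    by_cases hne : w = v
    · rw [hne]
    · exact absurd hwe (hu w (h.subset w hw) hne).ne)
  have hx : x = ε⁻¹ • ((u + ε • x) - u) := by
    rw [add_sub_cancel_left, smul_smul, inv_mul_cancel₀ hε.ne', one_smul]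
  rw [hx]
  exact Submodule.smul_mem _ _
    (Submodule.sub_mem _ (Submodule.subset_span hmem) (Submodule.subset_span hum))

end IsVertexSet

/-- A spanning simplicial cone is the nonnegative orthant of a basis of unit vectors. -/
theorem exists_unit_basis_of_isSimplicial {C : PointedCone ℝ (EuclideanSpace ℝ (Fin d))}
    (hC : C.IsSimplicial) (hspan : Submodule.span ℝ (C : Set (EuclideanSpace ℝ (Fin d))) = ⊤) :
    ∃ b : Module.Basis (Fin d) ℝ (EuclideanSpace ℝ (Fin d)),
      (∀ i, ‖b i‖ = 1) ∧ ∀ u, u ∈ C ↔ ∀ i, 0 ≤ b.repr u i := by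
  obtain ⟨s, hs, hli, rfl⟩ := hC
  have hs' : Submodule.span ℝ s = ⊤ := by
    rw [← top_le_iff, ← hspan, Submodule.span_le]
    exact fun x hx => PointedCone.hull_le_span (R := ℝ) s hx
  let b₀ : Module.Basis s ℝ (EuclideanSpace ℝ (Fin d)) :=
    Module.Basis.mk (v := fun x : s => (x : EuclideanSpace ℝ (Fin d))) hli (by simp [hs'])
  have hb₀ : ∀ x : s, b₀ x = x := fun x => Module.Basis.mk_apply hli _ x
  have := hs.fintype
  have hcard : Fintype.card s = d := by
    rw [← Module.finrank_eq_card_basis b₀, finrank_euclideanSpace_fin]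
  let b₁ := b₀.reindex (Fintype.equivFinOfCardEq hcard)
  have hb₁ : ∀ i, b₁ i ∈ s := fun i => by
    simp [b₁, hb₀]
  have hb₁' : ∀ x ∈ s, ∃ i, b₁ i = x := fun x hx =>
    ⟨Fintype.equivFinOfCardEq hcard ⟨x, hx⟩, by simp [b₁, hb₀]⟩
  have hpos : ∀ i, 0 < ‖b₁ i‖⁻¹ := fun i => inv_pos.2 (norm_pos_iff.2 (b₁.ne_zero i))
  have hunit : ∀ i, IsUnit (‖b₁ i‖⁻¹) := fun i => (hpos i).ne'.isUnit
  let b := b₁.isUnitSMul hunit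
  have hb : ∀ i, b i = ‖b₁ i‖⁻¹ • b₁ i := fun i => Module.Basis.isUnitSMul_apply hunit i
  refine ⟨b, fun i => ?_, fun u => ⟨fun hu => ?_, fun hu => ?_⟩⟩
  · rw [hb, norm_smul, norm_inv, norm_norm, inv_mul_cancel₀ (norm_ne_zero_iff.2 (b₁.ne_zero i))]
  · induction hu using Submodule.span_induction with
    | mem x hx =>
      intro i
      obtain ⟨j, rfl⟩ := hb₁' x hx
      have hj : b₁ j = ‖b₁ j‖ • b j := by
        rw [hb, smul_smul, mul_inv_cancel₀ (norm_ne_zero_iff.2 (b₁.ne_zero j)), one_smul]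
      rw [hj, map_smul, b.repr_self, Finsupp.smul_apply, smul_eq_mul]
      refine mul_nonneg (norm_nonneg _) ?_
      rw [Finsupp.single_apply]
      split_ifs <;> norm_num
    | zero => simp
    | add x y _ _ hx hy =>
      intro i
      rw [map_add, Finsupp.add_apply]
      exact add_nonneg (hx i) (hy i)
    | smul a x _ hx =>
      intro i
      have : b.repr (a • x) i = (a : ℝ) * b.repr x i := by
        rw [show a • x = (a : ℝ) • x from rfl, map_smul]; rfl
      rw [this]
      exact mul_nonneg a.2 (hx i)
  · rw [← b.sum_repr u]
    refine Submodule.sum_mem _ fun i _ => PointedCone.smul_mem _ (hu i) ?_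
    rw [hb]
    exact PointedCone.smul_mem _ (hpos i).le (PointedCone.subset_hull (hb₁ i))

end

section

variable {d : ℕ}

/-- The vertex cones of `V` are the nonnegative orthants of the bases `b v` of unit vectors. -/
structure IsSimplicialVertexFan (V : Finset (EuclideanSpace ℝ (Fin d)))
    (b : V → Module.Basis (Fin d) ℝ (EuclideanSpace ℝ (Fin d))) : Prop where
  nonempty : V.Nonempty
  norm_eq_one : ∀ v i, ‖b v i‖ = 1
  mem_iff : ∀ (v : V) u, u ∈ vertexCone V v ↔ ∀ i, 0 ≤ (b v).repr u i

theorem IsVertexSet.exists_isSimplicialVertexFan {P : Set (EuclideanSpace ℝ (Fin d))}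
    {V : Finset (EuclideanSpace ℝ (Fin d))} (h : IsVertexSet P V)
    (hs : IsSimplicialPolytopalFan (normalFan P)) : ∃ b, IsSimplicialVertexFan V b := by
  have key : ∀ v : V, ∃ b : Module.Basis (Fin d) ℝ (EuclideanSpace ℝ (Fin d)),
      (∀ i, ‖b i‖ = 1) ∧ ∀ u, u ∈ vertexCone V v ↔ ∀ i, 0 ≤ b.repr u i := by
    rintro ⟨v, hv⟩
    obtain ⟨C, hC, hCe⟩ := hs.simplicial _ (h.vertexCone_mem_normalFan hv)
    obtain ⟨b, hb, hb'⟩ := exists_unit_basis_of_isSimplicial hC (by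
      rw [hCe]; exact h.span_vertexCone hv)
    exact ⟨b, hb, fun u => by rw [← hb', ← SetLike.mem_coe, hCe]⟩
  choose b hb hb' using key
  exact ⟨b, h.nonempty, hb, hb'⟩

/-- The unit vectors spanning the rays of the fan. -/
def rays (V : Finset (EuclideanSpace ℝ (Fin d)))
    (b : V → Module.Basis (Fin d) ℝ (EuclideanSpace ℝ (Fin d))) :
    Finset (EuclideanSpace ℝ (Fin d)) :=
  open Classical in Finset.univ.image fun p : V × Fin d => b p.1 p.2

variable {V : Finset (EuclideanSpace ℝ (Fin d))}
  {b : V → Module.Basis (Fin d) ℝ (EuclideanSpace ℝ (Fin d))}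

theorem mem_rays {r : EuclideanSpace ℝ (Fin d)} : r ∈ rays V b ↔ ∃ v i, b v i = r := by
  simp [rays]

theorem basis_mem_rays (v : V) (i : Fin d) : b v i ∈ rays V b := mem_rays.2 ⟨v, i, rfl⟩

namespace IsSimplicialVertexFan

theorem basis_mem (h : IsSimplicialVertexFan V b) (v : V) (i : Fin d) :
    b v i ∈ vertexCone V v := by
  rw [h.mem_iff]
  intro j
  rw [(b v).repr_self, Finsupp.single_apply]
  split_ifs <;> norm_num

/-- A ray that lies in a vertex cone is one of its generators. -/
theorem exists_basis_eq (h : IsSimplicialVertexFan V b) {v w : V} {i : Fin d}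
    (hi : b v i ∈ vertexCone V w) : ∃ j, b w j = b v i := by
  set r := b v i with hr
  have hrv := h.basis_mem v i
  have hrw : ⟪r, (w : EuclideanSpace ℝ (Fin d))⟫ = ⟪r, (v : EuclideanSpace ℝ (Fin d))⟫ :=
    inner_eq_of_mem_vertexCone v.2 w.2 hrv hi
  set c := (b w).repr r with hc
  have hc0 : ∀ j, 0 ≤ c j := (h.mem_iff w r).1 hi
  have hsum : ∑ j, c j • b w j = r := (b w).sum_repr r
  have hle : ∀ j, c j * ⟪b w j, (v : EuclideanSpace ℝ (Fin d))⟫ ≤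
      c j * ⟪b w j, (w : EuclideanSpace ℝ (Fin d))⟫ := fun j =>
    mul_le_mul_of_nonneg_left (h.basis_mem w j v v.2) (hc0 j)
  have hexp : ∀ x, ⟪r, x⟫ = ∑ j, c j * ⟪b w j, x⟫ := fun x => by
    rw [← hsum, sum_inner]; simp only [real_inner_smul_left]
  have heq := (Finset.sum_eq_sum_iff_of_le (fun j _ => hle j)).1
    (by rw [← hexp, ← hexp, hrw])
  obtain ⟨j, hj⟩ : ∃ j, c j ≠ 0 := by
    by_contra! hcon
    have : r = 0 := by rw [← hsum]; simp [hcon]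
    exact (b v).ne_zero i this
  have hmem : ∀ j, c j ≠ 0 → b w j ∈ vertexCone V v := fun j hj =>
    mem_vertexCone_of_inner_eq (h.basis_mem w j)
      (mul_left_cancel₀ hj (heq j (Finset.mem_univ j)))
  have hzero : ∀ k, k ≠ i → (b v).repr (b w j) k = 0 := by
    intro k hk
    have h0 : ∑ l, c l * (b v).repr (b w l) k = 0 := by
      have : (b v).repr r k = 0 := by
        rw [hr, (b v).repr_self, Finsupp.single_apply, if_neg (Ne.symm hk)]
      rw [← this]
      conv_rhs => rw [← hsum]
      simp
    have hnn : ∀ l ∈ Finset.univ, 0 ≤ c l * (b v).repr (b w l) k := by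
      intro l _
      by_cases hl : c l = 0
      · simp [hl]
      · exact mul_nonneg (hc0 l) ((h.mem_iff v _).1 (hmem l hl) k)
    have := (Finset.sum_eq_zero_iff_of_nonneg hnn).1 h0 j (Finset.mem_univ j)
    exact (mul_eq_zero.1 this).resolve_left hj
  have hrepr : b w j = (b v).repr (b w j) i • r := by
    conv_lhs => rw [← (b v).sum_repr (b w j)]
    rw [Finset.sum_eq_single i (fun k _ hk => by rw [hzero k hk, zero_smul]) (by simp)]
  have hnn := (h.mem_iff v _).1 (hmem j hj) i
  have hone : (b v).repr (b w j) i = 1 := by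
    have := congrArg norm hrepr
    rw [norm_smul, h.norm_eq_one, h.norm_eq_one, mul_one, Real.norm_eq_abs,
      abs_of_nonneg hnn] at this
    exact this.symm
  exact ⟨j, by rw [hrepr, hone, one_smul]⟩

theorem exists_basis_eq_of_mem_rays (h : IsSimplicialVertexFan V b) {w : V}
    {r : EuclideanSpace ℝ (Fin d)} (hr : r ∈ rays V b) (hrw : r ∈ vertexCone V w) :
    ∃ j, b w j = r := by
  obtain ⟨v, i, rfl⟩ := mem_rays.1 hr
  exact h.exists_basis_eq hrw

/-- Across each facet of a vertex cone there is another vertex cone. -/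
theorem exists_adjacent (h : IsSimplicialVertexFan V b) (v : V) (i : Fin d) :
    ∃ w : V, (∀ k, k ≠ i → b v k ∈ vertexCone V w) ∧ b v i ∉ vertexCone V w := by
  set u := ∑ k ∈ Finset.univ.erase i, b v k with hu
  have hinner : ∀ x, ⟪u, x⟫ = ∑ k ∈ Finset.univ.erase i, ⟪b v k, x⟫ := fun x => sum_inner _ _ _
  have huv : u ∈ vertexCone V v := by
    intro w hw
    rw [hinner, hinner]
    exact Finset.sum_le_sum fun k _ => h.basis_mem v k w hw
  obtain ⟨w, hw, hwe, hwne⟩ : ∃ w ∈ V, ⟪u, w⟫ = ⟪u, (v : EuclideanSpace ℝ (Fin d))⟫ ∧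
      (w : EuclideanSpace ℝ (Fin d)) ≠ v := by
    by_contra! hcon
    obtain ⟨ε, hε, hmem⟩ := exists_pos_add_smul_mem_vertexCone (x := -(b v i)) huv (by
      intro w hw hwe
      rw [hcon w hw hwe])
    have := (h.mem_iff v _).1 hmem i
    have h0 : (b v).repr u i = 0 := by
      rw [hu, map_sum, Finsupp.finsetSum_apply]
      refine Finset.sum_eq_zero fun k hk => ?_
      rw [(b v).repr_self, Finsupp.single_apply, if_neg (Finset.ne_of_mem_erase hk)]
    simp [h0] at this
    linarith
  have heq := (Finset.sum_eq_sum_iff_of_le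
    (fun k (_ : k ∈ Finset.univ.erase i) => h.basis_mem v k w hw)).1
      (by rw [← hinner, ← hinner, hwe])
  have heq' : ∀ k, k ≠ i → ⟪b v k, w⟫ = ⟪b v k, (v : EuclideanSpace ℝ (Fin d))⟫ :=
    fun k hk => heq k (Finset.mem_erase.2 ⟨hk, Finset.mem_univ k⟩)
  refine ⟨⟨w, hw⟩, fun k hk => mem_vertexCone_of_inner_eq (h.basis_mem v k) (heq' k hk),
    fun hmem => hwne ?_⟩
  refine InnerProductSpace.ext_inner_left_basis (𝕜 := ℝ) (b v) fun k => ?_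
  by_cases hk : k = i
  · subst hk
    exact inner_eq_of_mem_vertexCone v.2 hw (h.basis_mem v k) hmem
  · exact heq' k hk

open Classical in
/-- Every ray lies in at least `d` vertex cones. -/
theorem le_card_cones (h : IsSimplicialVertexFan V b) {r : EuclideanSpace ℝ (Fin d)}
    (hr : r ∈ rays V b) :
    d ≤ (Finset.univ.filter fun v : V => r ∈ vertexCone V v).card := by
  obtain ⟨v, i, rfl⟩ := mem_rays.1 hr
  choose w hw hw' using h.exists_adjacent v
  let g : Fin d → V := fun k => if k = i then v else w k
  have hg : Function.Injective g := by
    intro k l hkl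
    by_contra hne
    have hor : k ≠ i ∨ l ≠ i := by
      by_contra! hcon
      exact hne (hcon.1.trans hcon.2.symm)
    have aux : ∀ k l : Fin d, k ≠ l → k ≠ i → g k = g l → False := by
      intro k l hne hk hkl
      have h1 : g k = w k := if_neg hk
      have h2 : b v k ∈ vertexCone V (g l) := by
        by_cases hl : l = i
        · have : g l = v := if_pos hl
          rw [this]; exact h.basis_mem v k
        · have : g l = w l := if_neg hl
          rw [this]; exact hw l k hne
      exact hw' k (h1 ▸ hkl ▸ h2)
    rcases hor with hk | hl
    · exact aux k l hne hk hkl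
    · exact aux l k (Ne.symm hne) hl hkl.symm
  calc d = (Finset.univ.image g).card := by
        rw [Finset.card_image_of_injective _ hg, Finset.card_univ, Fintype.card_fin]
    _ ≤ _ := by
        refine Finset.card_le_card fun x hx => ?_
        obtain ⟨k, _, rfl⟩ := Finset.mem_image.1 hx
        refine Finset.mem_filter.2 ⟨Finset.mem_univ _, ?_⟩
        by_cases hk : k = i
        · have : g k = v := if_pos hk
          rw [this]; exact h.basis_mem v i
        · have : g k = w k := if_neg hk
          rw [this]; exact hw k i (Ne.symm hk)

open Classical in
/-- Every vertex cone contains at most `d` rays. -/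
theorem card_rays_le (h : IsSimplicialVertexFan V b) (v : V) (S : Finset (rays V b)) :
    (S.filter fun r : rays V b => (r : EuclideanSpace ℝ (Fin d)) ∈ vertexCone V v).card ≤ d := by
  let g : Fin d → rays V b := fun i => ⟨b v i, basis_mem_rays v i⟩
  calc _ ≤ (Finset.univ.image g).card := by
        refine Finset.card_le_card fun r hr => ?_
        obtain ⟨j, hj⟩ := h.exists_basis_eq_of_mem_rays r.2 (Finset.mem_filter.1 hr).2
        exact Finset.mem_image.2 ⟨j, Finset.mem_univ _, Subtype.ext hj⟩
    _ ≤ d := by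
        simpa using Finset.card_image_le (s := Finset.univ) (f := g)

/-- The rays can be matched to distinct vertex cones containing them. -/
theorem exists_matching (h : IsSimplicialVertexFan V b) :
    ∃ f : rays V b → V, Function.Injective f ∧
      ∀ r, (r : EuclideanSpace ℝ (Fin d)) ∈ vertexCone V (f r) := by
  classical
  obtain ⟨f, hf, hf'⟩ := (Finset.all_card_le_biUnion_card_iff_exists_injective
    (fun r : rays V b => Finset.univ.filter fun v : V =>
      (r : EuclideanSpace ℝ (Fin d)) ∈ vertexCone V v)).1 (by
    intro S
    rcases S.eq_empty_or_nonempty with rfl | ⟨r₀, hr₀⟩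
    · simp
    have hd : 0 < d := by
      obtain ⟨v, i, _⟩ := mem_rays.1 r₀.2
      exact i.pos
    refine Nat.le_of_mul_le_mul_right ?_ hd
    refine Finset.card_mul_le_card_mul
      (fun (r : rays V b) (v : V) => (r : EuclideanSpace ℝ (Fin d)) ∈ vertexCone V v) ?_ ?_
    · intro r hr
      refine (h.le_card_cones r.2).trans (Finset.card_le_card fun v hv => ?_)
      exact Finset.mem_filter.2 ⟨Finset.mem_biUnion.2 ⟨r, hr, hv⟩, (Finset.mem_filter.1 hv).2⟩
    · intro v _
      exact h.card_rays_le v S)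
  exact ⟨f, hf, fun r => (Finset.mem_filter.1 (hf' r)).2⟩

end IsSimplicialVertexFan

end

section

variable {d : ℕ} {V : Finset (EuclideanSpace ℝ (Fin d))}

/-- The point whose inner products with the generators of the cone of `v` are prescribed by `h`,
as a linear function of `h`. -/
def vertexPoint (b : V → Module.Basis (Fin d) ℝ (EuclideanSpace ℝ (Fin d))) (v : V) :
    (rays V b → ℝ) →ₗ[ℝ] EuclideanSpace ℝ (Fin d) :=
  ∑ i, (LinearMap.proj (⟨b v i, basis_mem_rays v i⟩ : rays V b) :
      (rays V b → ℝ) →ₗ[ℝ] ℝ).smulRight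
    ((InnerProductSpace.toDual ℝ (EuclideanSpace ℝ (Fin d))).symm
      (LinearMap.toContinuousLinearMap ((b v).coord i)))

/-- The polyhedron with prescribed right-hand sides for the rays. -/
def rayPolyhedron (b : V → Module.Basis (Fin d) ℝ (EuclideanSpace ℝ (Fin d)))
    (h : rays V b → ℝ) : Set (EuclideanSpace ℝ (Fin d)) :=
  {x | ∀ r : rays V b, ⟪x, (r : EuclideanSpace ℝ (Fin d))⟫ ≤ h r}

/-- The cone of right-hand sides that are support vectors of polytopes deforming the fan. -/
def supportVectors (b : V → Module.Basis (Fin d) ℝ (EuclideanSpace ℝ (Fin d))) :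
    Set (rays V b → ℝ) :=
  {h | ∀ v, vertexPoint b v h ∈ rayPolyhedron b h}

variable {b : V → Module.Basis (Fin d) ℝ (EuclideanSpace ℝ (Fin d))}

theorem inner_vertexPoint (v : V) (h : rays V b → ℝ) (u : EuclideanSpace ℝ (Fin d)) :
    ⟪vertexPoint b v h, u⟫ = ∑ i, h ⟨b v i, basis_mem_rays v i⟩ * (b v).repr u i := by
  simp [vertexPoint, sum_inner, real_inner_smul_left]

theorem inner_vertexPoint_basis (v : V) (h : rays V b → ℝ) (i : Fin d) :
    ⟪vertexPoint b v h, b v i⟫ = h ⟨b v i, basis_mem_rays v i⟩ := by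
  classical
  rw [inner_vertexPoint, Finset.sum_eq_single i]
  · simp
  · intro j _ hj
    rw [(b v).repr_self, Finsupp.single_apply, if_neg (Ne.symm hj), mul_zero]
  · simp

theorem eq_vertexPoint {v : V} {h : rays V b → ℝ} {x : EuclideanSpace ℝ (Fin d)}
    (hx : ∀ i, ⟪x, b v i⟫ = h ⟨b v i, basis_mem_rays v i⟩) : x = vertexPoint b v h :=
  InnerProductSpace.ext_inner_right_basis (𝕜 := ℝ) (b v) fun i => by rw [hx, inner_vertexPoint_basis]

theorem isPolyhedron_rayPolyhedron (h : rays V b → ℝ) : IsPolyhedron (rayPolyhedron b h) := by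
  let e := Fintype.equivFin (rays V b)
  refine ⟨_, fun j => (e.symm j : EuclideanSpace ℝ (Fin d)), fun j => h (e.symm j), ?_⟩
  ext x
  exact e.symm.forall_congr_right.symm

theorem convex_supportVectors : Convex ℝ (supportVectors b) := by
  intro h hh h' hh' s t hs ht _ v r
  rw [map_add, map_smul, map_smul, inner_add_left, real_inner_smul_left, real_inner_smul_left]
  exact add_le_add (mul_le_mul_of_nonneg_left (hh v r) hs) (mul_le_mul_of_nonneg_left (hh' v r) ht)

theorem zero_mem_supportVectors : (0 : rays V b → ℝ) ∈ supportVectors b := by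
  intro v r
  simp

theorem isClosed_supportVectors : IsClosed (supportVectors b) := by
  have : supportVectors b = ⋂ (v) (r : rays V b),
      {h | ⟪vertexPoint b v h, (r : EuclideanSpace ℝ (Fin d))⟫ ≤ h r} := by
    ext h; simp [supportVectors, rayPolyhedron]
  rw [this]
  refine isClosed_iInter fun v => isClosed_iInter fun r => isClosed_le ?_ (continuous_apply r)
  exact ((vertexPoint b v).continuous_of_finiteDimensional).inner continuous_const

namespace IsSimplicialVertexFan

theorem inner_vertexPoint_ray (hV : IsSimplicialVertexFan V b) {v : V} (h : rays V b → ℝ)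
    (r : rays V b) (hr : (r : EuclideanSpace ℝ (Fin d)) ∈ vertexCone V v) :
    ⟪vertexPoint b v h, (r : EuclideanSpace ℝ (Fin d))⟫ = h r := by
  obtain ⟨j, hj⟩ := hV.exists_basis_eq_of_mem_rays r.2 hr
  have hr' : r = ⟨b v j, basis_mem_rays v j⟩ := Subtype.ext hj.symm
  rw [hr']
  exact inner_vertexPoint_basis v h j

theorem inner_le_inner_vertexPoint (hV : IsSimplicialVertexFan V b) {h : rays V b → ℝ} {v : V}
    {x u : EuclideanSpace ℝ (Fin d)} (hx : x ∈ rayPolyhedron b h) (hu : u ∈ vertexCone V v) :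
    ⟪x, u⟫ ≤ ⟪vertexPoint b v h, u⟫ := by
  rw [inner_vertexPoint]
  conv_lhs => rw [← (b v).sum_repr u, inner_sum]
  refine Finset.sum_le_sum fun i _ => ?_
  rw [real_inner_smul_right, mul_comm]
  exact mul_le_mul_of_nonneg_right (hx ⟨b v i, basis_mem_rays v i⟩) ((hV.mem_iff v u).1 hu i)

theorem isBounded_rayPolyhedron (hV : IsSimplicialVertexFan V b) (h : rays V b → ℝ) :
    Bornology.IsBounded (rayPolyhedron b h) := by
  refine isBounded_iff_forall_norm_le.2 ⟨∑ v, ‖vertexPoint b v h‖, fun x hx => ?_⟩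
  obtain ⟨v, hv, hxv⟩ := exists_mem_vertexCone hV.nonempty x
  have h1 := (hV.inner_le_inner_vertexPoint (v := ⟨v, hv⟩) hx hxv).trans
    (real_inner_le_norm _ _)
  have h2 : ‖x‖ ≤ ‖vertexPoint b ⟨v, hv⟩ h‖ := by
    rw [real_inner_self_eq_norm_mul_norm] at h1
    by_contra! hlt
    have hpos : 0 < ‖x‖ := (norm_nonneg _).trans_lt hlt
    exact absurd (le_of_mul_le_mul_right h1 hpos) (not_le.2 hlt)
  exact h2.trans (Finset.single_le_sum (f := fun v => ‖vertexPoint b v h‖)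
    (fun _ _ => norm_nonneg _) (Finset.mem_univ _))

theorem isPolytope_rayPolyhedron (hV : IsSimplicialVertexFan V b) {h : rays V b → ℝ}
    (hh : h ∈ supportVectors b) : IsPolytope (rayPolyhedron b h) := by
  obtain ⟨v, hv⟩ := hV.nonempty
  exact ⟨isPolyhedron_rayPolyhedron h, ⟨_, hh ⟨v, hv⟩⟩, hV.isBounded_rayPolyhedron h⟩

theorem supportFn_rayPolyhedron (hV : IsSimplicialVertexFan V b) {h : rays V b → ℝ}
    (hh : h ∈ supportVectors b) {v : V} {u : EuclideanSpace ℝ (Fin d)}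
    (hu : u ∈ vertexCone V v) :
    supportFn (rayPolyhedron b h) u = ⟪vertexPoint b v h, u⟫ :=
  supportFn_eq_of_isMax (hh v) fun _ hy => hV.inner_le_inner_vertexPoint hy hu

variable {P : Set (EuclideanSpace ℝ (Fin d))}

theorem rayPolyhedron_mem_deformationCone (hV : IsSimplicialVertexFan V b)
    (hP : IsVertexSet P V) (hc : IsCompact P) {h : rays V b → ℝ} (hh : h ∈ supportVectors b) :
    rayPolyhedron b h ∈ deformationCone (normalFan P) := by
  refine ⟨hV.isPolytope_rayPolyhedron hh, ?_⟩
  rintro _ ⟨F, hF, rfl⟩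
  refine ⟨{τ ∈ normalFan P | τ ⊆ normalCone F (rayPolyhedron b h)}, fun τ hτ => hτ.1,
    Set.Subset.antisymm (fun u hu => ?_) (Set.sUnion_subset fun τ hτ => hτ.2)⟩
  obtain ⟨τ, hτ, huτ, hτ'⟩ := hP.exists_normalFan_mem hc u
  refine ⟨τ, ⟨hτ, fun w hw p hp y hy => ?_⟩, huτ⟩
  obtain ⟨v, hv, ε, hε, -, hwv, hmem⟩ := hτ' w hw
  have h1 := hu p hp _ (hh ⟨v, hv⟩)
  have h2 := hV.inner_le_inner_vertexPoint (v := ⟨v, hv⟩) (hF.2.subset hp) hmem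
  have h3 := hV.inner_le_inner_vertexPoint (v := ⟨v, hv⟩) hy hwv
  rw [real_inner_comm, real_inner_comm p]
  rw [real_inner_comm, real_inner_comm p] at h1
  simp only [inner_add_right, real_inner_smul_right, inner_neg_right] at h2
  refine h3.trans (le_of_mul_le_mul_left ?_ hε)
  linarith

theorem exists_supportVector (hV : IsSimplicialVertexFan V b) (hP : IsVertexSet P V)
    {Q : Set (EuclideanSpace ℝ (Fin d))} (hQ : Q ∈ deformationCone (normalFan P)) :
    ∃ h ∈ supportVectors b, Q = rayPolyhedron b h := by
  have hQc := hQ.1.isCompact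
  have key : ∀ v : V, ∃ q ∈ Q, ∀ u ∈ vertexCone V v, ∀ y ∈ Q, ⟪y, u⟫ ≤ ⟪q, u⟫ := by
    rintro ⟨v, hv⟩
    obtain ⟨u, hu⟩ := hP.exposed v hv
    have hF := isFace_argmax hQc hQ.1.nonempty u
    obtain ⟨S, hS, hSe⟩ := hQ.2 _ ⟨_, hF, rfl⟩
    have huS := mem_normalCone_argmax (P := Q) u
    rw [hSe] at huS
    obtain ⟨τ, hτ, huτ⟩ := huS
    have hτe := hP.eq_vertexCone_of_mem hv hu (hS hτ) huτ
    obtain ⟨q, hq⟩ := hF.1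
    refine ⟨q, hq.1, fun w hw y hy => ?_⟩
    have hw' : w ∈ ⋃₀ S := ⟨τ, hτ, hτe ▸ hw⟩
    rw [← hSe] at hw'
    rw [real_inner_comm, real_inner_comm w]
    exact hw' q hq y hy
  choose q hqQ hq using key
  let h : rays V b → ℝ := fun r => supportFn Q r
  have hqv : ∀ v, q v = vertexPoint b v h := fun v => eq_vertexPoint fun i =>
    (supportFn_eq_of_isMax (hqQ v) (hq v _ (hV.basis_mem v i))).symm
  have hsub : Q ⊆ rayPolyhedron b h := fun x hx r => inner_le_supportFn hQc hx r
  refine ⟨h, fun v => hqv v ▸ hsub (hqQ v), Set.Subset.antisymm hsub fun x hx => ?_⟩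
  obtain ⟨k, a, β, hQe⟩ := hQ.1.polyhedron
  rw [hQe]
  intro j
  obtain ⟨v, hv, hjv⟩ := exists_mem_vertexCone hV.nonempty (a j)
  have h1 := hV.inner_le_inner_vertexPoint (v := ⟨v, hv⟩) hx hjv
  have h2 := hqQ ⟨v, hv⟩
  rw [hqv, hQe] at h2
  exact h1.trans (h2 j)

end IsSimplicialVertexFan

end

section

/-- An injective linear least-squares problem over a nonempty closed convex set has a unique
solution. -/
theorem exists_unique_leastSquares {m : ℕ} {ι : Type*} [Finite ι] {K : Set (ι → ℝ)}
    (hne : K.Nonempty) (hcl : IsClosed K) (hconv : Convex ℝ K)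
    (A : (ι → ℝ) →ₗ[ℝ] EuclideanSpace ℝ (Fin m)) (hA : Function.Injective A)
    (y : EuclideanSpace ℝ (Fin m)) :
    ∃ h ∈ K, (∀ h' ∈ K, ‖y - A h‖ ≤ ‖y - A h'‖) ∧
      ∀ g ∈ K, (∀ h' ∈ K, ‖y - A g‖ ≤ ‖y - A h'‖) → g = h := by
  have := Fintype.ofFinite ι
  have hcl' : IsClosed (A '' K) :=
    (LinearMap.isClosedEmbedding_of_injective (LinearMap.ker_eq_bot.2 hA)).isClosedMap K hcl
  have hconv' : Convex ℝ (A '' K) := hconv.linear_image A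
  have hmin : ∀ h ∈ K, (‖y - A h‖ = ⨅ w : (A '' K), ‖y - w‖) ↔
      ∀ h' ∈ K, ‖y - A h‖ ≤ ‖y - A h'‖ := by
    intro h hh
    have : Nonempty (A '' K) := ⟨⟨A h, h, hh, rfl⟩⟩
    have hbdd : BddBelow (Set.range fun w : (A '' K) => ‖y - w‖) :=
      ⟨0, Set.forall_mem_range.2 fun _ => norm_nonneg _⟩
    constructor
    · intro heq h' hh'
      rw [heq]
      exact ciInf_le hbdd ⟨A h', h', hh', rfl⟩
    · intro hle
      refine le_antisymm (le_ciInf ?_) (ciInf_le hbdd ⟨A h, h, hh, rfl⟩)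
      rintro ⟨_, h', hh', rfl⟩
      exact hle h' hh'
  obtain ⟨_, ⟨h, hh, rfl⟩, heq⟩ :=
    exists_norm_eq_iInf_of_complete_convex (hne.image A) hcl'.isComplete hconv' y
  refine ⟨h, hh, (hmin h hh).1 heq, fun g hg hgm => hA ?_⟩
  have h1 := (norm_eq_iInf_iff_real_inner_le_zero hconv' ⟨h, hh, rfl⟩).1 heq (A g) ⟨g, hg, rfl⟩
  have h2 := (norm_eq_iInf_iff_real_inner_le_zero hconv' ⟨g, hg, rfl⟩).1
    ((hmin g hg).2 hgm) (A h) ⟨h, hh, rfl⟩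
  have h3 : ⟪A g - A h, A g - A h⟫ = ⟪y - A h, A g - A h⟫ + ⟪y - A g, A h - A g⟫ := by
    simp only [inner_sub_left, inner_sub_right]
    ring
  have h4 : ⟪A g - A h, A g - A h⟫ ≤ 0 := by rw [h3]; linarith
  exact sub_eq_zero.1 (inner_self_eq_zero.1 (le_antisymm h4 real_inner_self_nonneg))

variable {d : ℕ} {V : Finset (EuclideanSpace ℝ (Fin d))}

/-- The square system obtained by evaluating, for each ray `r`, the linear piece of the support
function on the cone `f r` at the direction `U (k r)`. -/
def matchedSystem {m : ℕ} (b : V → Module.Basis (Fin d) ℝ (EuclideanSpace ℝ (Fin d)))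
    (f : rays V b → V) (k : rays V b → Fin m) (U : Fin m → EuclideanSpace ℝ (Fin d)) :
    (rays V b → ℝ) →ₗ[ℝ] (rays V b → ℝ) :=
  LinearMap.pi fun r => innerₗ (EuclideanSpace ℝ (Fin d)) (U (k r)) ∘ₗ vertexPoint b (f r)

/-- The evaluation of the support function at the directions `U`, as a linear function of its
values at the rays. -/
def evaluation {m : ℕ} (b : V → Module.Basis (Fin d) ℝ (EuclideanSpace ℝ (Fin d)))
    (c : Fin m → V) (U : Fin m → EuclideanSpace ℝ (Fin d)) :
    (rays V b → ℝ) →ₗ[ℝ] EuclideanSpace ℝ (Fin m) :=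
  (WithLp.linearEquiv 2 ℝ (Fin m → ℝ)).symm.toLinearMap ∘ₗ
    LinearMap.pi fun k => innerₗ (EuclideanSpace ℝ (Fin d)) (U k) ∘ₗ vertexPoint b (c k)

variable {b : V → Module.Basis (Fin d) ℝ (EuclideanSpace ℝ (Fin d))}

theorem matchedSystem_apply {m : ℕ} (f : rays V b → V) (k : rays V b → Fin m)
    (U : Fin m → EuclideanSpace ℝ (Fin d)) (h : rays V b → ℝ) (r : rays V b) :
    matchedSystem b f k U h r = ⟪vertexPoint b (f r) h, U (k r)⟫ := by
  rw [real_inner_comm]; rfl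

theorem evaluation_apply {m : ℕ} (c : Fin m → V) (U : Fin m → EuclideanSpace ℝ (Fin d))
    (h : rays V b → ℝ) (k : Fin m) :
    evaluation b c U h k = ⟪vertexPoint b (c k) h, U k⟫ := by
  rw [real_inner_comm]; rfl

theorem measurableSet_det_matchedSystem_ne_zero {m : ℕ} (f : rays V b → V)
    (k : rays V b → Fin m) :
    MeasurableSet {U : Fin m → EuclideanSpace ℝ (Fin d) |
      LinearMap.det (matchedSystem b f k U) ≠ 0} := by
  classical
  have hcont : Continuous fun U : Fin m → EuclideanSpace ℝ (Fin d) =>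
      LinearMap.det (matchedSystem b f k U) := by
    simp_rw [← LinearMap.det_toMatrix']
    refine Continuous.matrix_det (continuous_matrix fun r r' => ?_)
    simp only [LinearMap.toMatrix'_apply, matchedSystem_apply]
    fun_prop
  exact (isOpen_ne_fun hcont continuous_const).measurableSet

/-- For generic directions the matched square system is nonsingular. -/
theorem IsSimplicialVertexFan.ae_det_matchedSystem_ne_zero (hV : IsSimplicialVertexFan V b)
    {m : ℕ} {f : rays V b → V} (hf : ∀ r, (r : EuclideanSpace ℝ (Fin d)) ∈ vertexCone V (f r))
    {k : rays V b → Fin m} (hk : Function.Injective k) :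
    ∀ᵐ U : Fin m → EuclideanSpace ℝ (Fin d) ∂(volume : Measure (Fin m → EuclideanSpace ℝ (Fin d))),
      LinearMap.det (matchedSystem b f k U) ≠ 0 := by
  let U₀ : Fin m → EuclideanSpace ℝ (Fin d) := Function.extend k (fun r => r) 0
  have hU₀ : ∀ r, U₀ (k r) = r := fun r => hk.extend_apply _ _ r
  refine ae_mem_of_ae_add_linearMap_mem (LinearMap.toSpanSingleton ℝ _ U₀) volume volume
    (measurableSet_det_matchedSystem_ne_zero f k) fun U => ?_
  have hshift : ∀ t : ℝ, matchedSystem b f k (U + LinearMap.toSpanSingleton ℝ _ U₀ t) =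
      matchedSystem b f k U + t • LinearMap.id := by
    intro t
    refine LinearMap.ext fun h => funext fun r => ?_
    simp only [LinearMap.toSpanSingleton_apply, LinearMap.add_apply, LinearMap.smul_apply,
      LinearMap.id_apply, Pi.add_apply, Pi.smul_apply, matchedSystem_apply, inner_add_right,
      real_inner_smul_right, hU₀, hV.inner_vertexPoint_ray h r (hf r), smul_eq_mul]
  have hfin : {t : ℝ | Module.End.HasEigenvalue (matchedSystem b f k U) t}.Finite :=
    Module.End.finite_hasEigenvalue _
  have hfin' : ((fun t : ℝ => -t) ⁻¹'
      {t : ℝ | Module.End.HasEigenvalue (matchedSystem b f k U) t}).Finite :=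
    hfin.preimage neg_injective.injOn
  filter_upwards [hfin'.measure_zero volume |> compl_mem_ae_iff.2] with t ht
  change LinearMap.det (matchedSystem b f k _) ≠ 0
  rw [hshift]
  intro hdet
  refine ht ?_
  obtain ⟨h, hh, hne⟩ := (Submodule.ne_bot_iff _).1
    (LinearMap.bot_lt_ker_of_det_eq_zero hdet).ne'
  refine Module.End.hasEigenvalue_of_hasEigenvector (x := h) ⟨?_, hne⟩
  rw [Module.End.mem_eigenspace_iff]
  have := LinearMap.mem_ker.1 hh
  rw [LinearMap.add_apply, LinearMap.smul_apply, LinearMap.id_apply] at this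
  rw [neg_smul]
  exact eq_neg_of_add_eq_zero_left this

theorem loss_eq_norm_sub_sq {m : ℕ} (U : Fin m → EuclideanSpace ℝ (Fin d)) (y : Fin m → ℝ)
    {P : Set (EuclideanSpace ℝ (Fin d))} {z : EuclideanSpace ℝ (Fin m)}
    (hz : ∀ k, z k = supportFn P (U k)) :
    loss U y P = (1 / (m : ℝ)) * ‖WithLp.toLp 2 y - z‖ ^ 2 := by
  rw [loss, EuclideanSpace.real_norm_sq_eq]
  congr 1
  refine Finset.sum_congr rfl fun k _ => ?_
  rw [PiLp.sub_apply, hz]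
  ring

/-- If the support function is determined by its values at the directions `U`, then the
least-squares estimate is unique. -/
theorem IsSimplicialVertexFan.mem_uniqueDirections (hV : IsSimplicialVertexFan V b)
    {P : Set (EuclideanSpace ℝ (Fin d))} (hP : IsVertexSet P V) (hc : IsCompact P) {m : ℕ}
    (hm : 0 < m) {U : Fin m → EuclideanSpace ℝ (Fin d)} {c : Fin m → V}
    (hcU : ∀ k, U k ∈ vertexCone V (c k)) (hinj : Function.Injective (evaluation b c U)) :
    U ∈ uniqueDirections (normalFan P) m := by
  intro y
  have hloss : ∀ h ∈ supportVectors b, loss U y (rayPolyhedron b h) =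
      (1 / (m : ℝ)) * ‖WithLp.toLp 2 y - evaluation b c U h‖ ^ 2 := fun h hh =>
    loss_eq_norm_sub_sq U y fun k => by
      rw [evaluation_apply, hV.supportFn_rayPolyhedron hh (hcU k)]
  have hle : ∀ h ∈ supportVectors b, ∀ h' ∈ supportVectors b,
      (loss U y (rayPolyhedron b h) ≤ loss U y (rayPolyhedron b h') ↔
        ‖WithLp.toLp 2 y - evaluation b c U h‖ ≤ ‖WithLp.toLp 2 y - evaluation b c U h'‖) := by
    intro h hh h' hh'
    rw [hloss h hh, hloss h' hh', mul_le_mul_iff_right₀ (by positivity),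
      sq_le_sq₀ (norm_nonneg _) (norm_nonneg _)]
  obtain ⟨h, hh, hmin, huniq⟩ := exists_unique_leastSquares ⟨0, zero_mem_supportVectors⟩
    isClosed_supportVectors convex_supportVectors _ hinj (WithLp.toLp 2 y)
  refine Set.encard_eq_one.2 ⟨rayPolyhedron b h, Set.eq_singleton_iff_unique_mem.2
    ⟨⟨hV.rayPolyhedron_mem_deformationCone hP hc hh, fun Q hQ => ?_⟩, ?_⟩⟩
  · obtain ⟨h', hh', rfl⟩ := hV.exists_supportVector hP hQ
    exact (hle h hh h' hh').2 (hmin h' hh')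
  · rintro Q ⟨hQ, hQmin⟩
    obtain ⟨g, hg, rfl⟩ := hV.exists_supportVector hP hQ
    rw [huniq g hg fun h' hh' => (hle g hg h' hh').1
      (hQmin _ (hV.rayPolyhedron_mem_deformationCone hP hc hh'))]

end

end SupportRecon

end

theorem corollary3p13 {d : ℕ} (Δ : Set (Set (EuclideanSpace ℝ (Fin d))))
    (hΔ : SupportRecon.IsSimplicialPolytopalFan Δ) (m : ℕ) :
    ∀ᵐ U : Fin m → EuclideanSpace ℝ (Fin d) ∂(volume : Measure (Fin m → EuclideanSpace ℝ (Fin d))),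
      (∀ σ, Maximal (fun τ => τ ∈ Δ) σ → ∃ i : Fin m, U i ∈ intrinsicInterior ℝ σ) →
        U ∈ SupportRecon.uniqueDirections Δ m := by
  obtain ⟨P, hP, rfl⟩ := hΔ.polytopal
  obtain ⟨V, hsub, hmax, hexp⟩ := hP.exists_vertices
  have hVP : SupportRecon.IsVertexSet P V := ⟨hsub, hmax, hexp⟩
  obtain ⟨b, hV⟩ := hVP.exists_isSimplicialVertexFan hΔ
  obtain ⟨f, hf, hf'⟩ := hV.exists_matching
  have hgen : ∀ᵐ U : Fin m → EuclideanSpace ℝ (Fin d)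
      ∂(volume : Measure (Fin m → EuclideanSpace ℝ (Fin d))),
      ∀ k : SupportRecon.rays V b → Fin m, Function.Injective k →
        LinearMap.det (SupportRecon.matchedSystem b f k U) ≠ 0 := by
    refine ae_all_iff.2 fun k => ?_
    by_cases hk : Function.Injective k
    · filter_upwards [hV.ae_det_matchedSystem_ne_zero hf' hk] with U hU _ using hU
    · exact Filter.Eventually.of_forall fun U h => absurd h hk
  filter_upwards [hgen] with U hU hcov
  choose i hi using fun v : V => hcov _ (hVP.maximal_vertexCone v.2)
  have hi_unique : ∀ v w : V, U (i v) ∈ SupportRecon.vertexCone V w → w = v := fun v w hw =>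
    (Subtype.ext (hVP.eq_of_mem_intrinsicInterior v.2 w.2 (hi v) hw)).symm
  have hi_inj : Function.Injective i := fun v w hvw =>
    hi_unique w v (hvw ▸ intrinsicInterior_subset (hi v))
  have hcone : ∀ k, ∃ v : V, U k ∈ SupportRecon.vertexCone V v := fun k =>
    let ⟨v, hv, hk⟩ := SupportRecon.exists_mem_vertexCone hV.nonempty (U k)
    ⟨⟨v, hv⟩, hk⟩
  choose c hc using hcone
  have hm : 0 < m := by
    obtain ⟨v, hv⟩ := hV.nonempty
    exact (i ⟨v, hv⟩).pos
  refine hV.mem_uniqueDirections hVP hP.isCompact hm hc ?_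
  have hdet := hU (fun r => i (f r)) (hi_inj.comp hf)
  refine (injective_iff_map_eq_zero _).2 fun h hh => ?_
  by_contra hne
  refine hdet (LinearMap.det_eq_zero_iff_ker_ne_bot.2 ((Submodule.ne_bot_iff _).2
    ⟨h, LinearMap.mem_ker.2 (funext fun r => ?_), hne⟩))
  have hr : c (i (f r)) = f r := hi_unique (f r) _ (hc (i (f r)))
  have := SupportRecon.evaluation_apply c U h (i (f r))
  rw [hr, hh] at this
  rw [SupportRecon.matchedSystem_apply, ← this]
  rfl
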